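/- Let $\mathcal X\subseteq\mathbb R^n$ be closed, and let $\mathcal P_{\mathcal X}$ be the set of Borel probability measures on $\mathcal X$; write $\langle P,f\rangle$ for the expectation of $f$ under $P$. A hypothesis is a non-empty set $\mathcal H\subseteq\mathcal P_{\mathcal X}$. An e-variable for $\mathcal H$ is a Borel function $E:\mathcal X\to[0,+\infty)$ with $\langle P,E\rangle\le 1$ for all $P\in\mathcal H$, and an e-class is a set of e-variables. An e-class $\mathcal E$ is majorising if for every e-variable $E$ there is $E'\in\mathcal E$ with $E'(x)\ge E(x)$ for all $x\in\mathcal X$, and it is optimal if it is majorising and contained in every majorising e-class (so there is at most one optimal e-class). Let $\Phi':\mathcal X\to\mathbb R^{m'}$ and $\Phi'':\mathcal X\to\mathbb R^{m''}$ be continuous, and let $\Phi=(\Phi',\Phi''):\mathcal X\to\mathbb R^{m'+m''}$. Let $\mathcal H$ be a properly loosely constrained hypothesis with tight constraint $\Phi'$ and slack constraint $\Phi''$, that is, $0$ lies in the relative interior of the convex hull of $\Phi(\mathcal X)$ and $$\mathcal H=\{P\in\mathcal P_{\mathcal X}:\ \langle P,\|\Phi'\|_1\rangle<\infty,\ \langle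 P,\|\Phi''\|_1\rangle<\infty,\ \langle P,\Phi'\rangle=0,\ \langle P,\Phi''\rangle\ge 0\},$$ where the inequality is componentwise. Define $$\tilde\Lambda_{\Phi',\Phi''}=\{(\lambda',\lambda''):\ \lambda'\in\mathbb R^{m'},\ \lambda''\in[0,+\infty)^{m''},\ 1-\lambda'\cdot\Phi'(x)-\lambda''\cdot\Phi''(x)\ge 0\ \text{for all }x\in\mathcal X\}.$$ Then the optimal e-class for $\mathcal H$ exists and equals $$\tilde{\mathcal E}_{\mathcal H}^\vee=\{1-\lambda'\cdot\Phi'-\lambda''\cdot\Phi'':\ (\lambda',\lambda'')\in\tilde\Lambda_{\Phi',\Phi''}\}.$$ -/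

import Mathlib

open MeasureTheory

namespace EVar

/-! Throughout, `X` is a subset of `ℝⁿ` (closed in the theorem) with the induced topology and
Borel sigma-field, and `ProbabilityMeasure X` is the set of Borel probability measures on `X`.
Vectors of `ℝᵐ` are functions `Fin m → ℝ`, with the componentwise order. -/

section Hypotheses

variable {n : ℕ} {X : Set (EuclideanSpace ℝ (Fin n))}

/-- A hypothesis on `X`: a non-empty set of Borel probability measures on `X`. -/
def IsHypothesis (H : Set (ProbabilityMeasure X)) : Prop :=
  H.Nonempty

/-- The set of e-variables with respect to `H`: the non-negative Borel functions on `X` whose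
expectation (possibly infinite, a priori) is at most `1` under each measure in `H`. -/
def eVariables (H : Set (ProbabilityMeasure X)) : Set (X → ℝ) :=
  {E | Measurable E ∧ (∀ x, 0 ≤ E x) ∧
    ∀ P ∈ H, ∫⁻ x, ENNReal.ofReal (E x) ∂(P : Measure X) ≤ 1}

/-- An e-class is a set of e-variables. -/
def IsEClass (H : Set (ProbabilityMeasure X)) (C : Set (X → ℝ)) : Prop :=
  C ⊆ eVariables H

/-- A majorising e-class: each e-variable is majorised, everywhere on `X`, by an element of it. -/
def IsMajorising (H : Set (ProbabilityMeasure X)) (C : Set (X → ℝ)) : Prop :=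
  IsEClass H C ∧ ∀ E ∈ eVariables H, ∃ E' ∈ C, ∀ x, E x ≤ E' x

/-- An optimal e-class: a majorising e-class that is contained in every majorising e-class.
There is at most one. -/
def IsOptimal (H : Set (ProbabilityMeasure X)) (C : Set (X → ℝ)) : Prop :=
  IsMajorising H C ∧ ∀ C', IsMajorising H C' → C ⊆ C'

/-- The set of the `P` under which the 1-norm of `Φ` has finite expectation. -/
def finiteMean {m : ℕ} (Φ : X → Fin m → ℝ) : Set (ProbabilityMeasure X) :=
  {P | ∫⁻ x, ENNReal.ofReal (∑ i, |Φ x i|) ∂(P : Measure X) < ⊤}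

/-- The expectation of the vector-valued `Φ` under `P` (meaningful for `P ∈ finiteMean Φ`). -/
noncomputable def mean {m : ℕ} (P : ProbabilityMeasure X) (Φ : X → Fin m → ℝ) : Fin m → ℝ :=
  fun i => ∫ x, Φ x i ∂(P : Measure X)

/-- The map `x ↦ (Φ' x, Φ'' x)` into `ℝ^(m' + m'')`. -/
def joint {m' m'' : ℕ} (Φ' : X → Fin m' → ℝ) (Φ'' : X → Fin m'' → ℝ) :
    X → Fin (m' + m'') → ℝ :=
  fun x => Fin.append (Φ' x) (Φ'' x)

/-- `H` is a loosely constrained hypothesis, with tight constraint `Φ'` and slack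
constraint `Φ''`. -/
structure IsLooselyConstrained (H : Set (ProbabilityMeasure X)) {m' m'' : ℕ}
    (Φ' : X → Fin m' → ℝ) (Φ'' : X → Fin m'' → ℝ) : Prop where
  isHypothesis : IsHypothesis H
  continuous_tight : Continuous Φ'
  continuous_slack : Continuous Φ''
  zero_mem_conv : 0 ∈ convexHull ℝ (Set.range (joint Φ' Φ''))
  eq_setOf : H = {P | P ∈ finiteMean Φ' ∩ finiteMean Φ'' ∧ mean P Φ' = 0 ∧ 0 ≤ mean P Φ''}

/-- `H` is a properly loosely constrained hypothesis: moreover `0` lies in the relative interior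
(the interior within the affine hull) of the convex hull of the image of `(Φ', Φ'')`. -/
structure IsProperlyLooselyConstrained (H : Set (ProbabilityMeasure X)) {m' m'' : ℕ}
    (Φ' : X → Fin m' → ℝ) (Φ'' : X → Fin m'' → ℝ) : Prop
    extends IsLooselyConstrained H Φ' Φ'' where
  zero_mem_relint :
    0 ∈ intrinsicInterior ℝ (convexHull ℝ (Set.range (joint Φ' Φ'')))

/-- The function `1 - l' · Φ' - l'' · Φ''`. -/
def affineFun {m' m'' : ℕ} (Φ' : X → Fin m' → ℝ) (Φ'' : X → Fin m'' → ℝ)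
    (l : (Fin m' → ℝ) × (Fin m'' → ℝ)) : X → ℝ :=
  fun x => 1 - l.1 ⬝ᵥ Φ' x - l.2 ⬝ᵥ Φ'' x

/-- The pairs `(l', l'')` with `l'' ≥ 0` for which `1 - l' · Φ' - l'' · Φ''` is non-negative
on `X`. -/
def multipliers {m' m'' : ℕ} (Φ' : X → Fin m' → ℝ) (Φ'' : X → Fin m'' → ℝ) :
    Set ((Fin m' → ℝ) × (Fin m'' → ℝ)) :=
  {l | 0 ≤ l.2 ∧ ∀ x, 0 ≤ affineFun Φ' Φ'' l x}

/-- The set of the functions `1 - l' · Φ' - l'' · Φ''` with `(l', l'')` in `multipliers Φ' Φ''`. -/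
def dualClass {m' m'' : ℕ} (Φ' : X → Fin m' → ℝ) (Φ'' : X → Fin m'' → ℝ) : Set (X → ℝ) :=
  affineFun Φ' Φ'' '' multipliers Φ' Φ''

end Hypotheses

end EVar

namespace EVar

section LinearAlgebra

/-- **Farkas' lemma** for finitely many linear functionals on an arbitrary real vector space. -/
theorem exists_nonneg_combination_of_nonneg {V ι : Type*} [AddCommGroup V] [Module ℝ V]
    (s : Finset ι) (f : ι → V →ₗ[ℝ] ℝ) (g : V →ₗ[ℝ] ℝ)
    (h : ∀ v, (∀ i ∈ s, 0 ≤ f i v) → 0 ≤ g v) :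
    ∃ c : ι → ℝ, (∀ i, 0 ≤ c i) ∧ ∀ v, g v = ∑ i ∈ s, c i * f i v := by
  classical
  induction s using Finset.induction_on generalizing f g with
  | empty =>
    refine ⟨0, fun _ => le_rfl, fun v => ?_⟩
    have h1 := h v (by simp)
    have h2 := h (-v) (by simp)
    rw [map_neg] at h2
    simp only [Finset.sum_empty]
    linarith
  | insert a s ha ih =>
    by_cases hs : ∀ v, (∀ i ∈ s, 0 ≤ f i v) → 0 ≤ g v
    · obtain ⟨c, hc, hg⟩ := ih f g hs
      refine ⟨Function.update c a 0, fun i => ?_, fun v => ?_⟩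
      · by_cases hi : i = a
        · simp [hi]
        · simp [hi, hc i]
      · rw [Finset.sum_insert ha, hg v, Function.update_self, zero_mul, zero_add]
        refine Finset.sum_congr rfl fun i hi => ?_
        rw [Function.update_of_ne (ne_of_mem_of_not_mem hi ha)]
    · push Not at hs
      obtain ⟨u, hu, hgu⟩ := hs
      have hau : f a u < 0 := by
        by_contra! hcon
        refine absurd (h u fun i hi => ?_) (not_le.2 hgu)
        rcases Finset.mem_insert.1 hi with rfl | hi
        exacts [hcon, hu i hi]
      have hr : 0 < (-f a u)⁻¹ := inv_pos.2 (by linarith)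
      obtain ⟨w, hw, hgw, haw⟩ : ∃ w, (∀ i ∈ s, 0 ≤ f i w) ∧ g w < 0 ∧ f a w = -1 := by
        refine ⟨(-f a u)⁻¹ • u, fun i hi => ?_, ?_, ?_⟩
        · rw [map_smul, smul_eq_mul]
          exact mul_nonneg hr.le (hu i hi)
        · rw [map_smul, smul_eq_mul]
          exact mul_neg_of_pos_of_neg hr hgu
        · rw [map_smul, smul_eq_mul, inv_neg, neg_mul, inv_mul_cancel₀ hau.ne]
      obtain ⟨c, hc, hg⟩ := ih (fun i => f i + f i w • f a) (g + g w • f a) fun v hv => by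
        have key := h (v + f a v • w) fun i hi => by
          rcases Finset.mem_insert.1 hi with rfl | hi
          · simp [haw]
          · have := hv i hi
            simp only [LinearMap.add_apply, LinearMap.smul_apply, smul_eq_mul, map_add,
              map_smul] at this ⊢
            linarith
        simp only [LinearMap.add_apply, LinearMap.smul_apply, smul_eq_mul, map_add,
          map_smul] at key ⊢
        linarith
      refine ⟨Function.update c a (∑ i ∈ s, c i * f i w - g w), fun i => ?_, fun v => ?_⟩
      · by_cases hi : i = a
        · have := Finset.sum_nonneg fun i hi => mul_nonneg (hc i) (hw i hi)
          simp only [hi, Function.update_self]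
          linarith
        · simp [hi, hc i]
      · have hv := hg v
        simp only [LinearMap.add_apply, LinearMap.smul_apply, smul_eq_mul, mul_add,
          Finset.sum_add_distrib] at hv
        rw [Finset.sum_insert ha, Function.update_self, sub_mul, Finset.sum_mul]
        have e : ∑ i ∈ s, Function.update c a (∑ i ∈ s, c i * f i w - g w) i * f i v
            = ∑ i ∈ s, c i * f i v := Finset.sum_congr rfl fun i hi => by
          rw [Function.update_of_ne (ne_of_mem_of_not_mem hi ha)]
        simp only [mul_assoc] at hv ⊢
        linarith

/-- Conic duality: if the non-negative combinations of the `Φ x` fill their linear span and those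
falling in the cone `C` have non-negative `h`-weight, then some functional on the span is
non-negative on `C` and is bounded above by `h` along `Φ`. -/
theorem exists_functional_le {X V : Type*} [AddCommGroup V] [Module ℝ V] (Φ : X → V)
    (C : PointedCone ℝ V) (h : X → ℝ)
    (hspan : ∀ v ∈ Submodule.span ℝ (Set.range Φ),
      ∃ a : X →₀ ℝ, 0 ≤ a ∧ Finsupp.linearCombination ℝ Φ a = v)
    (hC : ∀ a : X →₀ ℝ, 0 ≤ a → Finsupp.linearCombination ℝ Φ a ∈ C →
      0 ≤ Finsupp.linearCombination ℝ h a) :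
    ∃ l : Submodule.span ℝ (Set.range Φ) →ₗ[ℝ] ℝ,
      (∀ x, l ⟨Φ x, Submodule.subset_span ⟨x, rfl⟩⟩ ≤ h x) ∧
        ∀ v : Submodule.span ℝ (Set.range Φ), (v : V) ∈ C → 0 ≤ l v := by
  let L := Submodule.span ℝ (Set.range Φ)
  let K : PointedCone ℝ (L × ℝ) :=
    { carrier := {p | ∃ a : X →₀ ℝ, 0 ≤ a ∧ Finsupp.linearCombination ℝ Φ a - p.1 ∈ C ∧
        Finsupp.linearCombination ℝ h a ≤ p.2}
      zero_mem' := ⟨0, le_rfl, by simp, by simp⟩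
      add_mem' := by
        rintro p q ⟨a, ha, hap, hap'⟩ ⟨b, hb, hbq, hbq'⟩
        refine ⟨a + b, add_nonneg ha hb, ?_, ?_⟩
        · have := add_mem hap hbq
          simpa [add_sub_add_comm] using this
        · rw [map_add]
          exact add_le_add hap' hbq'
      smul_mem' := by
        rintro ⟨r, hr⟩ p ⟨a, ha, hap, hap'⟩
        refine ⟨r • a, smul_nonneg hr ha, ?_, ?_⟩
        · have := C.smul_mem hr hap
          simpa [smul_sub] using this
        · rw [map_smul]
          exact mul_le_mul_of_nonneg_left hap' hr }
  have hK : ∀ p : L × ℝ, p ∈ K ↔ ∃ a : X →₀ ℝ, 0 ≤ a ∧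
      Finsupp.linearCombination ℝ Φ a - p.1 ∈ C ∧ Finsupp.linearCombination ℝ h a ≤ p.2 :=
    fun _ => Iff.rfl
  let f : L × ℝ →ₗ.[ℝ] ℝ :=
    ⟨(LinearMap.fst ℝ L ℝ).ker, (LinearMap.snd ℝ L ℝ).comp (Submodule.subtype _)⟩
  obtain ⟨g, hgf, hgK⟩ := riesz_extension K f
    (by
      rintro ⟨⟨v, t⟩, hv⟩ hmem
      obtain rfl : v = 0 := by simpa [f] using hv
      obtain ⟨a, ha, hac, hat⟩ := (hK _).1 hmem
      exact (hC a ha (by simpa using hac)).trans hat)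
    (by
      rintro ⟨v, t⟩
      obtain ⟨a, ha, hav⟩ := hspan v v.2
      refine ⟨⟨(0, Finsupp.linearCombination ℝ h a - t), by simp [f]⟩, (hK _).2 ⟨a, ha, ?_, ?_⟩⟩
      · simp [hav]
      · simp)
  have hg : ∀ v : L, ∀ t : ℝ, g (v, t) = g (v, 0) + t := fun v t => by
    have h1 := hgf ⟨(0, t), by simp [f]⟩
    have h2 : g (0, t) = t := h1
    rw [← h2, ← map_add]
    simp [h2]
  refine ⟨-(g.comp (LinearMap.inl ℝ L ℝ)), fun x => ?_, fun v hv => ?_⟩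
  · have hx := hgK (⟨Φ x, Submodule.subset_span ⟨x, rfl⟩⟩, h x)
      ((hK _).2 ⟨Finsupp.single x 1, by simp, by simp, by simp⟩)
    rw [hg] at hx
    change -g (⟨Φ x, _⟩, 0) ≤ h x
    linarith
  · have hx := hgK (-v, 0) ((hK _).2 ⟨0, le_rfl, by simpa using hv, by simp⟩)
    have hneg : ((-v, 0) : L × ℝ) = -(v, 0) := by simp
    rw [hneg, map_neg] at hx
    exact hx

/-- If `0` is a relative interior point of the convex hull of `s`, every vector in the linear span
of `s` can be scaled into the convex hull. -/
theorem exists_pos_smul_mem_convexHull {V : Type*} [NormedAddCommGroup V] [NormedSpace ℝ V]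
    {s : Set V} (h0 : 0 ∈ intrinsicInterior ℝ (convexHull ℝ s)) {v : V}
    (hv : v ∈ Submodule.span ℝ s) : ∃ ε : ℝ, 0 < ε ∧ ε • v ∈ convexHull ℝ s := by
  set A := affineSpan ℝ (convexHull ℝ s) with hA
  obtain ⟨y, hy, hy0⟩ : ∃ y : A, y ∈ interior ((↑) ⁻¹' convexHull ℝ s : Set A) ∧ (y : V) = 0 :=
    mem_intrinsicInterior.1 h0
  have hA0 : (0 : V) ∈ A := hy0 ▸ y.2
  have hle : Submodule.span ℝ s ≤ A.direction := Submodule.span_le.2 fun w hw => by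
    have := AffineSubspace.vsub_mem_direction
      (subset_affineSpan ℝ _ (subset_convexHull ℝ s hw) : w ∈ A) hA0
    rwa [vsub_eq_sub, sub_zero] at this
  have hmem : ∀ t : ℝ, t • v ∈ A := fun t => by
    have := AffineSubspace.vadd_mem_of_mem_direction (A.direction.smul_mem t (hle hv)) hA0
    simpa using this
  let γ : ℝ → A := fun t => ⟨t • v, hmem t⟩
  have hγ : Continuous γ := by fun_prop
  have hγ0 : γ 0 = y := Subtype.ext (by simp [γ, hy0])
  have hev : ∀ᶠ t in nhds (0 : ℝ), γ t ∈ ((↑) ⁻¹' convexHull ℝ s : Set A) :=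
    hγ.continuousAt.eventually (hγ0 ▸ mem_interior_iff_mem_nhds.1 hy)
  obtain ⟨ε, hε, hball⟩ := Metric.eventually_nhds_iff.1 hev
  refine ⟨ε / 2, by positivity, hball ?_⟩
  rw [Real.dist_0_eq_abs, abs_of_pos (by positivity)]
  linarith

theorem exists_nonneg_linearCombination_eq {X V : Type*} [AddCommGroup V] [Module ℝ V]
    {Φ : X → V} {v : V} (hv : v ∈ convexHull ℝ (Set.range Φ)) :
    ∃ a : X →₀ ℝ, 0 ≤ a ∧ Finsupp.linearCombination ℝ Φ a = v := by
  have hconv : Convex ℝ (Finsupp.linearCombination ℝ Φ '' {a | 0 ≤ a}) := by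
    refine Convex.linear_image (fun a ha b hb r t hr ht _ => ?_) _
    simp only [Set.mem_ofPred_eq] at ha hb ⊢
    exact add_nonneg (smul_nonneg hr ha) (smul_nonneg ht hb)
  have hsub : Set.range Φ ⊆ Finsupp.linearCombination ℝ Φ '' {a | 0 ≤ a} := by
    rintro _ ⟨x, rfl⟩
    exact ⟨Finsupp.single x 1, by simp, by simp⟩
  exact convexHull_min hsub hconv hv

/-- If `0` is a relative interior point of the convex hull of the range of `Φ`, a functional that
is non-negative along `Φ` vanishes along `Φ`. -/
theorem eq_zero_of_nonneg_range {X V : Type*} [NormedAddCommGroup V] [NormedSpace ℝ V]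
    {Φ : X → V} (h0 : 0 ∈ intrinsicInterior ℝ (convexHull ℝ (Set.range Φ)))
    (l : V →ₗ[ℝ] ℝ) (hl : ∀ x, 0 ≤ l (Φ x)) (x : X) : l (Φ x) = 0 := by
  obtain ⟨ε, hε, hmem⟩ := exists_pos_smul_mem_convexHull h0
    (neg_mem (Submodule.subset_span (Set.mem_range_self x)))
  obtain ⟨a, ha, hav⟩ := exists_nonneg_linearCombination_eq hmem
  have h1 : 0 ≤ l (ε • -Φ x) := by
    rw [← hav, Finsupp.linearCombination_apply, Finsupp.sum, map_sum]
    refine Finset.sum_nonneg fun y _ => ?_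
    rw [map_smul, smul_eq_mul]
    exact mul_nonneg (ha y) (hl y)
  rw [map_smul, map_neg, smul_eq_mul] at h1
  nlinarith [hl x]

end LinearAlgebra

section Measures

variable {n : ℕ} {X : Set (EuclideanSpace ℝ (Fin n))}

/-- The finitely supported measure with weights `a`. -/
noncomputable def discreteMeasure (a : X →₀ ℝ) : Measure X :=
  ∑ x ∈ a.support, ENNReal.ofReal (a x) • Measure.dirac x

theorem lintegral_discreteMeasure (a : X →₀ ℝ) (f : X → ENNReal) :
    ∫⁻ x, f x ∂discreteMeasure a = ∑ x ∈ a.support, ENNReal.ofReal (a x) * f x := by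
  simp [discreteMeasure, lintegral_finsetSum_measure, lintegral_smul_measure]

theorem integral_discreteMeasure {a : X →₀ ℝ} (ha : 0 ≤ a) (f : X → ℝ) :
    ∫ x, f x ∂discreteMeasure a = Finsupp.linearCombination ℝ f a := by
  have hint : ∀ x ∈ a.support, Integrable f (ENNReal.ofReal (a x) • Measure.dirac x) :=
    fun x _ => (integrable_dirac (by simp)).smul_measure ENNReal.ofReal_ne_top
  rw [discreteMeasure, integral_finsetSum_measure hint, Finsupp.linearCombination_apply,
    Finsupp.sum]
  refine Finset.sum_congr rfl fun x _ => ?_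
  rw [integral_smul_measure, integral_dirac, ENNReal.toReal_ofReal (ha x)]

theorem isProbabilityMeasure_discreteMeasure {a : X →₀ ℝ} (ha : 0 ≤ a)
    (hsum : Finsupp.linearCombination ℝ (fun _ : X => (1 : ℝ)) a = 1) :
    IsProbabilityMeasure (discreteMeasure a) := by
  constructor
  rw [← lintegral_one, lintegral_discreteMeasure]
  simp only [mul_one]
  rw [← ENNReal.ofReal_sum_of_nonneg fun x _ => ha x]
  simpa [Finsupp.linearCombination_apply, Finsupp.sum] using hsum

theorem discreteMeasure_finiteMean {m : ℕ} (a : X →₀ ℝ) (Φ : X → Fin m → ℝ) :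
    ∫⁻ x, ENNReal.ofReal (∑ i, |Φ x i|) ∂discreteMeasure a < ⊤ := by
  rw [lintegral_discreteMeasure]
  exact ENNReal.sum_lt_top.2 fun x _ => ENNReal.mul_lt_top ENNReal.ofReal_lt_top
    ENNReal.ofReal_lt_top

theorem linearCombination_apply_coord {α ι : Type*} (Φ : α → ι → ℝ) (a : α →₀ ℝ) (i : ι) :
    Finsupp.linearCombination ℝ Φ a i = Finsupp.linearCombination ℝ (fun x => Φ x i) a := by
  simp [Finsupp.linearCombination_apply, Finsupp.sum]

theorem integrable_coord_of_mem_finiteMean {m : ℕ} {P : ProbabilityMeasure X}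
    {Φ : X → Fin m → ℝ} (hΦ : Continuous Φ) (hP : P ∈ finiteMean Φ) (i : Fin m) :
    Integrable (fun x => Φ x i) (P : Measure X) := by
  have hc : Continuous fun x => Φ x i := (continuous_apply i).comp hΦ
  refine ⟨hc.measurable.aestronglyMeasurable, ?_⟩
  rw [hasFiniteIntegral_iff_norm]
  refine lt_of_le_of_lt (lintegral_mono fun x => ENNReal.ofReal_le_ofReal ?_) hP
  rw [Real.norm_eq_abs]
  exact Finset.single_le_sum (f := fun j => |Φ x j|) (fun j _ => abs_nonneg _)
    (Finset.mem_univ i)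

theorem integrable_dotProduct {m : ℕ} {P : ProbabilityMeasure X}
    {Φ : X → Fin m → ℝ} (hΦ : Continuous Φ) (hP : P ∈ finiteMean Φ) (l : Fin m → ℝ) :
    Integrable (fun x => l ⬝ᵥ Φ x) (P : Measure X) :=
  integrable_finsetSum _ fun i _ => (integrable_coord_of_mem_finiteMean hΦ hP i).const_mul _

theorem integral_dotProduct {m : ℕ} {P : ProbabilityMeasure X}
    {Φ : X → Fin m → ℝ} (hΦ : Continuous Φ) (hP : P ∈ finiteMean Φ) (l : Fin m → ℝ) :
    ∫ x, l ⬝ᵥ Φ x ∂(P : Measure X) = l ⬝ᵥ mean P Φ := by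
  simp only [dotProduct, mean]
  rw [integral_finsetSum _ fun i _ =>
    (integrable_coord_of_mem_finiteMean hΦ hP i).const_mul _]
  simp only [integral_const_mul]

end Measures

section Optimality

variable {n m' m'' : ℕ} {X : Set (EuclideanSpace ℝ (Fin n))} {H : Set (ProbabilityMeasure X)}
  {Φ' : X → Fin m' → ℝ} {Φ'' : X → Fin m'' → ℝ}

theorem IsLooselyConstrained.isEClass_dualClass (hH : IsLooselyConstrained H Φ' Φ'') :
    IsEClass H (dualClass Φ' Φ'') := by
  rintro _ ⟨l, ⟨hl, hnn⟩, rfl⟩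
  have hcont : Continuous (affineFun Φ' Φ'' l) := by
    have h1 := hH.continuous_tight
    have h2 := hH.continuous_slack
    unfold affineFun
    fun_prop
  refine ⟨hcont.measurable, hnn, fun P hP => ?_⟩
  rw [hH.eq_setOf] at hP
  obtain ⟨⟨hP', hP''⟩, hm', hm''⟩ := hP
  have i1 := integrable_dotProduct hH.continuous_tight hP' l.1
  have i2 := integrable_dotProduct hH.continuous_slack hP'' l.2
  have i0 : Integrable (fun _ : X => (1 : ℝ)) (P : Measure X) := integrable_const 1
  have hint : Integrable (affineFun Φ' Φ'' l) (P : Measure X) := (i0.sub i1).sub i2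
  rw [← ofReal_integral_eq_lintegral_ofReal hint (Filter.Eventually.of_forall hnn),
    ENNReal.ofReal_le_one]
  have hval : ∫ x, affineFun Φ' Φ'' l x ∂(P : Measure X) = 1 - 0 - l.2 ⬝ᵥ mean P Φ'' := by
    have e1 : ∫ x, affineFun Φ' Φ'' l x ∂(P : Measure X) =
        ∫ x, (1 - l.1 ⬝ᵥ Φ' x) ∂(P : Measure X)
        - ∫ x, l.2 ⬝ᵥ Φ'' x ∂(P : Measure X) := integral_sub (i0.sub i1) i2
    rw [e1, integral_sub i0 i1,
      integral_dotProduct hH.continuous_tight hP', integral_dotProduct hH.continuous_slack hP'',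
      hm']
    simp
  rw [hval]
  have := dotProduct_nonneg_of_nonneg hl hm''
  linarith

/-- An e-variable has mean at most the total mass under every finitely supported measure that
satisfies the constraints. -/
theorem IsLooselyConstrained.linearCombination_le (hH : IsLooselyConstrained H Φ' Φ'')
    {E : X → ℝ} (hE : E ∈ eVariables H) {a : X →₀ ℝ} (ha : 0 ≤ a)
    (h' : Finsupp.linearCombination ℝ Φ' a = 0) (h'' : 0 ≤ Finsupp.linearCombination ℝ Φ'' a) :
    Finsupp.linearCombination ℝ E a ≤ Finsupp.linearCombination ℝ (fun _ => (1 : ℝ)) a := by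
  rcases eq_or_ne a 0 with rfl | hne
  · simp
  have hpos : 0 < Finsupp.linearCombination ℝ (fun _ => (1 : ℝ)) a := by
    simp only [Finsupp.linearCombination_apply, Finsupp.sum, smul_eq_mul, mul_one]
    refine Finset.sum_pos (fun x hx => ?_) (Finsupp.support_nonempty_iff.2 hne)
    exact lt_of_le_of_ne (ha x) (Finsupp.mem_support_iff.1 hx).symm
  set r := Finsupp.linearCombination ℝ (fun _ : X => (1 : ℝ)) a
  set b := r⁻¹ • a
  have hr : 0 ≤ r⁻¹ := inv_nonneg.2 hpos.le
  have hb : 0 ≤ b := smul_nonneg hr ha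
  have hb1 : Finsupp.linearCombination ℝ (fun _ : X => (1 : ℝ)) b = 1 := by
    rw [map_smul, smul_eq_mul]
    exact inv_mul_cancel₀ hpos.ne'
  let P : ProbabilityMeasure X :=
    ⟨discreteMeasure b, isProbabilityMeasure_discreteMeasure hb hb1⟩
  have hmean : ∀ {k : ℕ} (Φ : X → Fin k → ℝ),
      mean P Φ = r⁻¹ • Finsupp.linearCombination ℝ Φ a := fun Φ => by
    ext i
    rw [← map_smul, linearCombination_apply_coord, ← integral_discreteMeasure hb]
    rfl
  have hP : P ∈ H := by
    rw [hH.eq_setOf]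
    refine ⟨⟨discreteMeasure_finiteMean b Φ', discreteMeasure_finiteMean b Φ''⟩, ?_, ?_⟩
    · rw [hmean, h', smul_zero]
    · rw [hmean]
      exact smul_nonneg hr h''
  have hle : ∫⁻ x, ENNReal.ofReal (E x) ∂discreteMeasure b ≤ 1 := hE.2.2 P hP
  rw [lintegral_discreteMeasure] at hle
  have hval : ∑ x ∈ b.support, ENNReal.ofReal (b x) * ENNReal.ofReal (E x)
      = ENNReal.ofReal (Finsupp.linearCombination ℝ E b) := by
    simp only [Finsupp.linearCombination_apply, Finsupp.sum, smul_eq_mul]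
    rw [ENNReal.ofReal_sum_of_nonneg fun x _ => mul_nonneg (hb x) (hE.2.1 x)]
    exact Finset.sum_congr rfl fun x _ => (ENNReal.ofReal_mul (hb x)).symm
  rw [hval, ENNReal.ofReal_le_one, map_smul, smul_eq_mul, inv_mul_le_iff₀ hpos, mul_one] at hle
  exact hle

/-- The cone of the vectors whose first `m'` coordinates vanish and whose last `m''` coordinates
are non-negative. -/
def constraintCone (m' m'' : ℕ) : PointedCone ℝ (Fin (m' + m'') → ℝ) where
  carrier := {v | (∀ i, v (Fin.castAdd m'' i) = 0) ∧ ∀ j, 0 ≤ v (Fin.natAdd m' j)}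
  zero_mem' := ⟨fun _ => rfl, fun _ => le_rfl⟩
  add_mem' := fun hv hw =>
    ⟨fun i => by simp [hv.1 i, hw.1 i], fun j => add_nonneg (hv.2 j) (hw.2 j)⟩
  smul_mem' := fun r v hv =>
    ⟨fun i => by simp [hv.1 i], fun j => mul_nonneg r.2 (hv.2 j)⟩

/-- A functional on a subspace that is non-negative on the constraint cone is given by multipliers,
the slack ones being non-negative. -/
theorem exists_multipliers (L : Submodule ℝ (Fin (m' + m'') → ℝ)) (g : L →ₗ[ℝ] ℝ)
    (hg : ∀ v : L, (v : Fin (m' + m'') → ℝ) ∈ constraintCone m' m'' → 0 ≤ g v) :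
    ∃ (l' : Fin m' → ℝ) (l'' : Fin m'' → ℝ), 0 ≤ l'' ∧ ∀ v : L,
      g v = (l' ⬝ᵥ fun i => (v : Fin (m' + m'') → ℝ) (Fin.castAdd m'' i)) +
        l'' ⬝ᵥ fun j => (v : Fin (m' + m'') → ℝ) (Fin.natAdd m' j) := by
  let π : Fin (m' + m'') → L →ₗ[ℝ] ℝ := fun k => (LinearMap.proj k).comp L.subtype
  let f : (Fin m' ⊕ Fin m') ⊕ Fin m'' → L →ₗ[ℝ] ℝ :=
    Sum.elim (Sum.elim (fun i => π (Fin.castAdd m'' i)) fun i => -π (Fin.castAdd m'' i))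
      fun j => π (Fin.natAdd m' j)
  obtain ⟨c, hc, hgc⟩ := exists_nonneg_combination_of_nonneg Finset.univ f g fun v hv => by
    refine hg v ⟨fun i => le_antisymm ?_ ?_, fun j => ?_⟩
    · have : 0 ≤ -(v : Fin (m' + m'') → ℝ) (Fin.castAdd m'' i) :=
        hv (.inl (.inr i)) (Finset.mem_univ _)
      linarith
    · exact hv (.inl (.inl i)) (Finset.mem_univ _)
    · exact hv (.inr j) (Finset.mem_univ _)
  refine ⟨fun i => c (.inl (.inl i)) - c (.inl (.inr i)), fun j => c (.inr j),
    fun j => hc _, fun v => ?_⟩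
  rw [hgc v]
  simp only [Fintype.sum_sum_type, f, π, Sum.elim_inl, Sum.elim_inr, dotProduct, sub_mul,
    Finset.sum_sub_distrib, LinearMap.neg_apply, LinearMap.comp_apply, LinearMap.proj_apply,
    Submodule.subtype_apply, mul_neg, Finset.sum_neg_distrib]
  ring

theorem linearCombination_joint_castAdd (a : X →₀ ℝ) (i : Fin m') :
    Finsupp.linearCombination ℝ (joint Φ' Φ'') a (Fin.castAdd m'' i) =
      Finsupp.linearCombination ℝ Φ' a i := by
  simp [linearCombination_apply_coord, joint]

theorem linearCombination_joint_natAdd (a : X →₀ ℝ) (j : Fin m'') :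
    Finsupp.linearCombination ℝ (joint Φ' Φ'') a (Fin.natAdd m' j) =
      Finsupp.linearCombination ℝ Φ'' a j := by
  simp [linearCombination_apply_coord, joint]

theorem IsProperlyLooselyConstrained.isMajorising_dualClass
    (hH : IsProperlyLooselyConstrained H Φ' Φ'') : IsMajorising H (dualClass Φ' Φ'') := by
  refine ⟨hH.isEClass_dualClass, fun E hE => ?_⟩
  obtain ⟨g, hgE, hgC⟩ := exists_functional_le (joint Φ' Φ'') (constraintCone m' m'')
    (fun x => 1 - E x)
    (fun v hv => by
      obtain ⟨ε, hε, hmem⟩ := exists_pos_smul_mem_convexHull hH.zero_mem_relint hv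
      obtain ⟨a, ha, hav⟩ := exists_nonneg_linearCombination_eq hmem
      exact ⟨ε⁻¹ • a, smul_nonneg (inv_nonneg.2 hε.le) ha, by
        rw [map_smul, hav, inv_smul_smul₀ hε.ne']⟩)
    (fun a ha hmem => by
      have key := hH.linearCombination_le hE ha
        (by ext i; rw [← linearCombination_joint_castAdd (Φ'' := Φ'')]; exact hmem.1 i)
        (fun j => by rw [← linearCombination_joint_natAdd (Φ' := Φ')]; exact hmem.2 j)
      simp only [Finsupp.linearCombination_apply, Finsupp.sum, smul_eq_mul, mul_sub,
        Finset.sum_sub_distrib] at key ⊢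
      linarith)
  obtain ⟨l', l'', hl, hgl⟩ := exists_multipliers _ g hgC
  have hle : ∀ x, E x ≤ affineFun Φ' Φ'' (l', l'') x := fun x => by
    have h1 := hgE x
    rw [hgl] at h1
    simp only [joint, Fin.append_left, Fin.append_right] at h1
    simp only [affineFun]
    linarith
  exact ⟨_, ⟨(l', l''), ⟨hl, fun x => (hE.2.1 x).trans (hle x)⟩, rfl⟩, hle⟩

/-- The elements of the dual class are maximal in it. -/
theorem IsProperlyLooselyConstrained.affineFun_eq_of_le
    (hH : IsProperlyLooselyConstrained H Φ' Φ'') {k l : (Fin m' → ℝ) × (Fin m'' → ℝ)}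
    (hkl : ∀ x, affineFun Φ' Φ'' k x ≤ affineFun Φ' Φ'' l x) :
    affineFun Φ' Φ'' k = affineFun Φ' Φ'' l := by
  let g : (Fin (m' + m'') → ℝ) →ₗ[ℝ] ℝ :=
    dotProductBilin ℝ ℝ (Fin.append (k.1 - l.1) (k.2 - l.2))
  have hg : ∀ x, g (joint Φ' Φ'' x) = affineFun Φ' Φ'' l x - affineFun Φ' Φ'' k x := fun x => by
    simp only [g, joint, dotProductBilin_apply_apply, affineFun, dotProduct, Fin.sum_univ_add,
      Fin.append_left, Fin.append_right, Pi.sub_apply, sub_mul, Finset.sum_sub_distrib]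
    ring
  ext x
  have := eq_zero_of_nonneg_range hH.zero_mem_relint g
    (fun y => by rw [hg]; linarith [hkl y]) x
  rw [hg] at this
  linarith

theorem IsProperlyLooselyConstrained.isOptimal_dualClass
    (hH : IsProperlyLooselyConstrained H Φ' Φ'') : IsOptimal H (dualClass Φ' Φ'') := by
  refine ⟨hH.isMajorising_dualClass, fun C hC => ?_⟩
  rintro _ ⟨k, hk, rfl⟩
  obtain ⟨E, hEC, hkE⟩ := hC.2 _ (hH.isEClass_dualClass ⟨k, hk, rfl⟩)
  obtain ⟨_, ⟨l, -, rfl⟩, hEl⟩ := hH.isMajorising_dualClass.2 E (hC.1 hEC)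
  have hkl := hH.affineFun_eq_of_le fun x => (hkE x).trans (hEl x)
  have hE : E = affineFun Φ' Φ'' k :=
    funext fun x => le_antisymm (hkl ▸ hEl x) (hkE x)
  exact hE ▸ hEC

theorem IsOptimal.eq {C D : Set (X → ℝ)} (hC : IsOptimal H C) (hD : IsOptimal H D) : C = D :=
  Set.Subset.antisymm (hC.2 D hD.1) (hD.2 C hC.1)

end Optimality

end EVar

theorem proposition9p3 {n m' m'' : ℕ} (X : Set (EuclideanSpace ℝ (Fin n))) (hX : IsClosed X)
    (H : Set (MeasureTheory.ProbabilityMeasure X))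
    (Φ' : X → Fin m' → ℝ) (Φ'' : X → Fin m'' → ℝ)
    (hH : EVar.IsProperlyLooselyConstrained H Φ' Φ'') :
    (∃! C : Set (X → ℝ), EVar.IsOptimal H C) ∧
      EVar.IsOptimal H (EVar.dualClass Φ' Φ'') :=
  ⟨⟨_, hH.isOptimal_dualClass, fun _ hC => hC.eq hH.isOptimal_dualClass⟩,
    hH.isOptimal_dualClass⟩
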